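/- For $d \ge 0$ and a non-empty set $S \subseteq \mathbb{R}^d$ and $\epsilon > 0$, let $P(S,\epsilon)$ be the maximum number of points of $S$ such that the open balls of radius $\epsilon$ centred at these points are pairwise disjoint ($P(S,\epsilon)=\infty$ if there is no maximum). The lower and upper Minkowski dimensions of $S$ are $$\underline{\dim}_M(S) = \liminf_{\epsilon \downarrow 0} \frac{\log P(S,\epsilon)}{\log \epsilon^{-1}}, \qquad \overline{\dim}_M(S) = \limsup_{\epsilon \downarrow 0} \frac{\log P(S,\epsilon)}{\log \epsilon^{-1}} .$$ **Theorem.** Let $(B_t)_{t \ge 0}$ be a standard Brownian motion in $\mathbb{R}^d$ (started at $0$), let $f : [0,1] \to \mathbb{R}^d$ be a càdlàg function (right continuous with left limits), and let $A$ be a non-empty subset of $[0,1]$ (not necessarily measurable). Write $(B+f)(A) = \{B_t + f(t) : t \in A\}$. Then there exist real constants $c_1$ and $c_2$ (not depending on the randomness) such that, almost surely, $$\underline{\dim}_M (B+f)(A) = c_1 \quad\text{and}\quad \overline{\dim}_M (B+f)(A) = c_2 .$$ -/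

import Mathlib

open MeasureTheory ProbabilityTheory Filter Topology
open scoped NNReal ENNReal

/-- A standard Brownian motion in `ℝ^d`: its coordinates are independent (as processes) standard
one-dimensional Brownian motions, started at `0` and with almost surely continuous paths. -/
structure IsStandardBrownian {Ω : Type*} [MeasurableSpace Ω] {d : ℕ}
    (B : ℝ≥0 → Ω → EuclideanSpace ℝ (Fin d)) (P : Measure Ω) : Prop where
  coord : ∀ i : Fin d, IsBrownianReal (fun t ω ↦ B t ω i) P
  indep : iIndepFun (fun (i : Fin d) (ω : Ω) (t : ℝ≥0) ↦ B t ω i) P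

/-- A function is càdlàg if it is right continuous and has left limits at every point. At the least
point of `T` the filter `𝓝[<] t` is trivial, so nothing is required of the left limit there. -/
def IsCadlag {T E : Type*} [TopologicalSpace T] [Preorder T] [TopologicalSpace E]
    (f : T → E) : Prop :=
  ∀ t : T, ContinuousWithinAt f (Set.Ici t) t ∧ ∃ l : E, Tendsto f (𝓝[<] t) (𝓝 l)

/-- The maximum number `k` of points `x₁, …, x_k` of `S` such that the balls of radius `ε` centred
at them are pairwise disjoint (`⊤` if there is no maximum). -/
noncomputable def ballPackingNumber {E : Type*} [PseudoMetricSpace E] (S : Set E) (ε : ℝ) : ℕ∞ :=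
  ⨆ (k : ℕ) (_ : ∃ x : Fin k → E, (∀ i, x i ∈ S) ∧
    Pairwise fun i j ↦ Disjoint (Metric.ball (x i) ε) (Metric.ball (x j) ε)), (k : ℕ∞)

/-- The quotient `log P(S, ε) / log ε⁻¹`, with values in the extended reals. -/
noncomputable def packingExponent {E : Type*} [PseudoMetricSpace E] (S : Set E) (ε : ℝ) : EReal :=
  ENNReal.log (ballPackingNumber S ε : ℝ≥0∞) / (Real.log ε⁻¹ : EReal)

/-- The lower Minkowski dimension of `S`. -/
noncomputable def lowerMinkowskiDim {E : Type*} [PseudoMetricSpace E] (S : Set E) : EReal :=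
  liminf (fun ε : ℝ ↦ packingExponent S ε) (𝓝[>] 0)

/-- The upper Minkowski dimension of `S`. -/
noncomputable def upperMinkowskiDim {E : Type*} [PseudoMetricSpace E] (S : Set E) : EReal :=
  limsup (fun ε : ℝ ↦ packingExponent S ε) (𝓝[>] 0)

/-!
Only the independence of the increments of `B` and the regularity of the paths matter. Let
`N(ε)` be the packing number of the image `(B + f)(A)` at scale `ε`. The point is that `N(ε)`
concentrates so strongly that, up to a factor polynomial in `log ε⁻¹`, it is almost surely equal to
a deterministic quantity as `ε` runs through the powers of `1 / 2`. Such factors do not affect the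
Minkowski dimensions (`minkowskiDim_le_of_eventually`), so that any two typical paths give the same
dimensions, and the constants can be read off from a single typical path.

For the concentration, cut `[0, 1]` into consecutive pieces so short that the image of each piece
has packing number at most `1` with probability close to one; this is possible because `B` is
continuous and `f` is càdlàg (`IsCadlag.exists_pieces`). The packing numbers `N(i, j)` of the images
of the blocks of pieces `[i, j)` are monotone and subadditive in the block, and consecutive blocks
are independent because a packing number depends on increments only (`IsIndepCount`). Two
arguments use this structure.

* If a block reaches `m` with probability at most `1 / 2`, then its packing number has an
  exponential tail at scale `m + 1`: after the first piece at which `m` is reached, the rest of the block is an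
  independent count dominated by the original one (`IsIndepCount.measure_mul_le`).
* Cut `[0, 1]` greedily into blocks that reach `m` with probability just over `1 / 2`. Either there
  are many of them, and by independence one of them reaches `m` with overwhelming probability, or
  there are few, and `N(ε)` is a short sum of counts with exponential tails
  (`IsIndepCount.measure_lt_le_or`).

Taking for `m` the largest number reached with probability at least `1 - 2⁻ⁿ` at the scale
`ε = 2⁻ⁿ`, both deviations are summable, and the Borel–Cantelli lemma applies
(`exists_ae_eventually_ballPackingNumber_driftImage`).

The set `A` need not be measurable, so it is first replaced by a countable subset `A'` over which
the graph of `f` is dense in the graph of `f` over `A`; the image of `A'` is then dense in the image of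
`A` for every continuous path, and passing to a dense subset only changes the scale by a factor
(`ballPackingNumber_le_of_subset_closure`). On the countable set `A'`, the process may also be
replaced by a modification that is measurable at each time.
-/

/-! ### Packing numbers -/

section Packing

variable {E : Type*} [PseudoMetricSpace E] {S T : Set E} {ε δ : ℝ}

theorem card_le_ballPackingNumber {ι : Type*} [Fintype ι] (x : ι → E) (hx : ∀ i, x i ∈ S)
    (hd : Pairwise fun i j ↦ Disjoint (Metric.ball (x i) ε) (Metric.ball (x j) ε)) :
    (Fintype.card ι : ℕ∞) ≤ ballPackingNumber S ε := by
  refine le_iSup₂_of_le (Fintype.card ι) ⟨x ∘ (Fintype.equivFin ι).symm, fun i ↦ hx _, ?_⟩ le_rfl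
  exact fun i j hij ↦ hd ((Fintype.equivFin ι).symm.injective.ne hij)

theorem ballPackingNumber_le_iff {a : ℕ∞} :
    ballPackingNumber S ε ≤ a ↔ ∀ (k : ℕ) (x : Fin k → E), (∀ i, x i ∈ S) →
      (Pairwise fun i j ↦ Disjoint (Metric.ball (x i) ε) (Metric.ball (x j) ε)) → (k : ℕ∞) ≤ a := by
  simp only [ballPackingNumber, iSup_le_iff, forall_exists_index, and_imp]

theorem le_ballPackingNumber_iff {k : ℕ} :
    (k : ℕ∞) ≤ ballPackingNumber S ε ↔ ∃ x : Fin k → E, (∀ i, x i ∈ S) ∧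
      Pairwise fun i j ↦ Disjoint (Metric.ball (x i) ε) (Metric.ball (x j) ε) := by
  refine ⟨fun h ↦ ?_, fun ⟨x, hx, hd⟩ ↦ by simpa using card_le_ballPackingNumber x hx hd⟩
  rcases Nat.eq_zero_or_pos k with rfl | hk
  · exact ⟨Fin.elim0, fun i ↦ i.elim0, fun i ↦ i.elim0⟩
  by_contra hcon
  have : ballPackingNumber S ε ≤ ((k - 1 : ℕ) : ℕ∞) := by
    refine ballPackingNumber_le_iff.2 fun l x hx hd ↦ ?_
    by_contra hl
    have hkl : k ≤ l := by
      have : k - 1 < l := by exact_mod_cast not_le.1 hl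
      omega
    exact hcon ⟨fun i ↦ x (Fin.castLE hkl i), fun i ↦ hx _,
      fun i j hij ↦ hd ((Fin.castLE_injective hkl).ne hij)⟩
  have := h.trans this
  have : k ≤ k - 1 := by exact_mod_cast this
  omega

theorem ballPackingNumber_mono (h : S ⊆ T) : ballPackingNumber S ε ≤ ballPackingNumber T ε :=
  ballPackingNumber_le_iff.2 fun k x hx hd ↦ by
    simpa using card_le_ballPackingNumber x (fun i ↦ h (hx i)) hd

theorem ballPackingNumber_anti (h : δ ≤ ε) : ballPackingNumber S ε ≤ ballPackingNumber S δ :=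
  ballPackingNumber_le_iff.2 fun k x hx hd ↦ by
    simpa using card_le_ballPackingNumber x hx
      fun i j hij ↦ (hd hij).mono (Metric.ball_subset_ball h) (Metric.ball_subset_ball h)

theorem ballPackingNumber_union_le :
    ballPackingNumber (S ∪ T) ε ≤ ballPackingNumber S ε + ballPackingNumber T ε := by
  classical
  refine ballPackingNumber_le_iff.2 fun k x hx hd ↦ ?_
  have h1 := card_le_ballPackingNumber (S := S) (ε := ε) (fun i : {i // x i ∈ S} ↦ x i)
    (fun i ↦ i.2) fun i j hij ↦ hd (Subtype.coe_injective.ne hij)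
  have h2 := card_le_ballPackingNumber (S := T) (ε := ε) (fun i : {i // ¬ x i ∈ S} ↦ x i)
    (fun i ↦ (hx i).resolve_left i.2) fun i j hij ↦ hd (Subtype.coe_injective.ne hij)
  refine le_trans ?_ (add_le_add h1 h2)
  have := Fintype.card_subtype_compl (fun i ↦ x i ∈ S)
  have h3 := Fintype.card_subtype_le (fun i ↦ x i ∈ S)
  rw [Fintype.card_fin] at this h3
  exact_mod_cast (show k ≤ _ by omega)

@[simp]
theorem ballPackingNumber_empty : ballPackingNumber (∅ : Set E) ε = 0 := by
  refine le_antisymm (ballPackingNumber_le_iff.2 fun k x hx _ ↦ ?_) bot_le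
  rcases Nat.eq_zero_or_pos k with rfl | hk
  · simp
  · exact (hx ⟨0, hk⟩).elim

theorem one_le_ballPackingNumber (h : S.Nonempty) : 1 ≤ ballPackingNumber S ε := by
  obtain ⟨s, hs⟩ := h
  simpa using card_le_ballPackingNumber (ι := Unit) (ε := ε) (fun _ ↦ s) (fun _ ↦ hs)
    fun i j hij ↦ (hij rfl).elim

/-- A set in which any two points are at distance less than `ε` carries at most one ball. -/
theorem ballPackingNumber_le_one (hS : ∀ x ∈ S, ∀ y ∈ S, dist x y < ε) :
    ballPackingNumber S ε ≤ 1 := by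
  refine ballPackingNumber_le_iff.2 fun k x hx hd ↦ ?_
  by_contra! hk
  have hk : 1 < k := by exact_mod_cast hk
  have h := hS _ (hx ⟨0, by omega⟩) _ (hx ⟨1, hk⟩)
  have h0 : 0 < ε := dist_nonneg.trans_lt h
  refine Set.disjoint_left.1 (hd (i := ⟨0, by omega⟩) (j := ⟨1, hk⟩) (by simp))
    (Metric.mem_ball_self h0) (Metric.mem_ball.2 h)

end Packing

section PackingNormed

variable {E : Type*} [NormedAddCommGroup E] [NormedSpace ℝ E] {S T : Set E} {ε : ℝ}

theorem le_ballPackingNumber_iff_dist (hε : 0 < ε) {k : ℕ} :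
    (k : ℕ∞) ≤ ballPackingNumber S ε ↔ ∃ x : Fin k → E, (∀ i, x i ∈ S) ∧
      Pairwise fun i j ↦ 2 * ε ≤ dist (x i) (x j) := by
  simp [le_ballPackingNumber_iff, disjoint_ball_ball_iff hε hε, two_mul]

/-- Passing to a dense subset costs at most a halving of the radius. -/
theorem ballPackingNumber_le_of_subset_closure (hε : 0 < ε) (h : S ⊆ closure T) :
    ballPackingNumber S ε ≤ ballPackingNumber T (ε / 2) := by
  refine ENat.forall_natCast_le_iff_le.1 fun k hk ↦ ?_
  obtain ⟨x, hx, hd⟩ := (le_ballPackingNumber_iff_dist hε).1 hk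
  choose y hyT hy using fun i ↦ Metric.mem_closure_iff.1 (h (hx i)) (ε / 2) (half_pos hε)
  refine (le_ballPackingNumber_iff_dist (half_pos hε)).2 ⟨y, hyT, fun i j hij ↦ ?_⟩
  have h1 := hd hij
  have h2 := dist_triangle4 (x i) (y i) (y j) (x j)
  have h3 := hy i
  have h4 := hy j
  rw [dist_comm (x j)] at h4
  simp only at h1 ⊢
  linarith

/-- Comparison of volumes: the packing number of a bounded set in a space of dimension `d` is
at most of order `ε⁻ᵈ`. -/
theorem exists_ballPackingNumber_le [FiniteDimensional ℝ E] (hS : Bornology.IsBounded S) :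
    ∃ C : ℝ, 1 ≤ C ∧ ∀ ε : ℝ, 0 < ε → ε ≤ 1 → ∃ n : ℕ, ballPackingNumber S ε = n ∧
      (n : ℝ) ≤ C * ε⁻¹ ^ Module.finrank ℝ E := by
  borelize E
  let μ : Measure E := Measure.addHaar
  obtain ⟨R, hR0, hR⟩ := hS.subset_ball_lt 0 0
  refine ⟨(R + 1) ^ Module.finrank ℝ E, one_le_pow₀ (by linarith), fun ε hε hε1 ↦ ?_⟩
  have key : ∀ k : ℕ, (k : ℕ∞) ≤ ballPackingNumber S ε →
      (k : ℝ) ≤ (R + 1) ^ Module.finrank ℝ E * ε⁻¹ ^ Module.finrank ℝ E := by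
    intro k hk
    obtain ⟨x, hx, hd⟩ := le_ballPackingNumber_iff.1 hk
    have hsub : (⋃ i, Metric.ball (x i) ε) ⊆ Metric.ball 0 (R + 1) := by
      refine Set.iUnion_subset fun i ↦ Metric.ball_subset_ball' ?_
      have := hR (hx i)
      rw [Metric.mem_ball] at this
      linarith
    have h1 := measure_mono (μ := μ) hsub
    rw [measure_iUnion hd (fun i ↦ measurableSet_ball)] at h1
    simp only [Measure.addHaar_ball_of_pos μ _ hε,
      Measure.addHaar_ball_of_pos μ _ (show 0 < R + 1 by linarith),
      tsum_fintype, Finset.sum_const, Finset.card_univ, Fintype.card_fin, nsmul_eq_mul] at h1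
    rw [← mul_assoc, ENNReal.mul_le_mul_iff_left (Metric.measure_ball_pos μ 0 one_pos).ne'
      measure_ball_lt_top.ne, ← ENNReal.ofReal_natCast, ← ENNReal.ofReal_mul (by positivity),
      ENNReal.ofReal_le_ofReal_iff (by positivity)] at h1
    rw [inv_pow, ← div_eq_mul_inv, le_div_iff₀ (by positivity)]
    exact h1
  have hne : ballPackingNumber S ε ≠ ⊤ := by
    intro htop
    obtain ⟨k, hk⟩ := exists_nat_gt ((R + 1) ^ Module.finrank ℝ E * ε⁻¹ ^ Module.finrank ℝ E)
    exact absurd (key k (htop ▸ le_top)) (not_le.2 hk)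
  obtain ⟨n, hn⟩ := ENat.ne_top_iff_exists.1 hne
  exact ⟨n, hn.symm, key n hn.le⟩

end PackingNormed

/-! ### Comparison of Minkowski dimensions -/

section Dimension

theorem packingExponent_eq {E : Type*} [PseudoMetricSpace E] {S : Set E} {ε : ℝ} {n : ℕ}
    (hn : ballPackingNumber S ε = n) (h1 : 1 ≤ n) :
    packingExponent S ε = ((Real.log n / Real.log ε⁻¹ : ℝ) : EReal) := by
  have hn0 : (0 : ℝ) < n := by exact_mod_cast h1
  rw [packingExponent, hn, EReal.coe_div]
  congr 1
  rw [← ENNReal.log_ofReal_of_pos hn0, ENNReal.ofReal_natCast]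
  simp

theorem map_mul_left_nhdsGT_zero {c : ℝ} (hc : 0 < c) :
    map (fun x : ℝ ↦ c * x) (𝓝[>] 0) = 𝓝[>] 0 := by
  conv_lhs => rw [← comap_mulLeft_nhdsGT_zero hc]
  exact map_comap_of_surjective (mul_left_surjective₀ hc.ne') _

theorem tendsto_log_inv_nhdsGT_zero :
    Tendsto (fun ε : ℝ ↦ Real.log ε⁻¹) (𝓝[>] 0) atTop :=
  Real.tendsto_log_atTop.comp tendsto_inv_nhdsGT_zero

theorem eventually_add_log_div_lt (K : ℝ) {η : ℝ} (hη : 0 < η) :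
    ∀ᶠ x : ℝ in atTop, (K + 2 * Real.log x) / x < η := by
  have h1 : Tendsto (fun x : ℝ ↦ K / x) atTop (𝓝 0) := tendsto_const_nhds.div_atTop tendsto_id
  have h2 : Tendsto (fun x : ℝ ↦ Real.log x / x) atTop (𝓝 0) :=
    Real.isLittleO_log_id_atTop.tendsto_div_nhds_zero
  have h3 := h1.add (h2.const_mul 2)
  simp only [mul_zero, add_zero] at h3
  filter_upwards [h3.eventually (gt_mem_nhds hη)] with x hx
  rwa [add_div, mul_div_assoc]

variable {E : Type*} [NormedAddCommGroup E] [NormedSpace ℝ E] [FiniteDimensional ℝ E]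

/-- A factor of order `(log ε⁻¹)²` in the packing number and a factor `4` in the radius are
invisible to the packing exponents in the limit. -/
theorem eventually_packingExponent_le {S T : Set E} (hS : S.Nonempty)
    (hSb : Bornology.IsBounded S) (hT : T.Nonempty) (hTb : Bornology.IsBounded T) {C : ℝ}
    (hC : 0 < C)
    (h : ∀ᶠ ε : ℝ in 𝓝[>] 0, ∀ a b : ℕ, ballPackingNumber S ε = a →
      ballPackingNumber T (4⁻¹ * ε) = b → (a : ℝ) ≤ C * Real.log ε⁻¹ ^ 2 * b)
    {η : ℝ} (hη : 0 < η) :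
    ∀ᶠ ε : ℝ in 𝓝[>] 0, packingExponent S ε ≤ packingExponent T (4⁻¹ * ε) + (η : EReal) := by
  obtain ⟨CS, -, hCS⟩ := exists_ballPackingNumber_le hSb
  obtain ⟨CT, hCT1, hCT⟩ := exists_ballPackingNumber_le hTb
  set D : ℕ := Module.finrank ℝ E
  have hl4 : 0 < Real.log 4 := Real.log_pos (by norm_num)
  filter_upwards [h, Ioc_mem_nhdsGT one_pos, tendsto_log_inv_nhdsGT_zero.eventually
    (eventually_ge_atTop 1), tendsto_log_inv_nhdsGT_zero.eventually
    (eventually_add_log_div_lt (Real.log C + Real.log 4 * (Real.log CT + D)) hη)]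
    with ε h ⟨hε0, hε1⟩ hL hη
  obtain ⟨a, ha, -⟩ := hCS ε hε0 hε1
  obtain ⟨b, hb, hbC⟩ := hCT (4⁻¹ * ε) (by positivity) (by linarith)
  have hab := h a b ha hb
  have ha1 : 1 ≤ a := by exact_mod_cast ha ▸ one_le_ballPackingNumber (ε := ε) hS
  have hb1 : 1 ≤ b := by exact_mod_cast hb ▸ one_le_ballPackingNumber (ε := 4⁻¹ * ε) hT
  have ha0 : (0 : ℝ) < a := by exact_mod_cast ha1
  have hb0 : (0 : ℝ) < b := by exact_mod_cast hb1
  rw [packingExponent_eq ha ha1, packingExponent_eq hb hb1, ← EReal.coe_add, EReal.coe_le_coe_iff]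
  have hlog : Real.log (4⁻¹ * ε)⁻¹ = Real.log 4 + Real.log ε⁻¹ := by
    rw [mul_inv, inv_inv, Real.log_mul (by norm_num) (inv_pos.2 hε0).ne']
  have e1 := Real.log_le_log ha0 hab
  have e2 := Real.log_le_log hb0 hbC
  rw [Real.log_mul (by positivity) (by positivity), Real.log_mul (by positivity) (by positivity),
    Real.log_pow] at e1
  rw [Real.log_mul (by positivity) (by positivity), Real.log_pow, hlog] at e2
  rw [hlog]
  have hCT0 : 0 ≤ Real.log CT := Real.log_nonneg hCT1
  generalize Real.log ε⁻¹ = L at *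
  generalize Real.log (4 : ℝ) = l at *
  have hL0 : 0 < L := by linarith
  -- changing the radius from `ε` to `ε / 4` changes the exponent by `O(1 / L)`, because the exponent
  -- itself is bounded
  have e3 : Real.log b / L ≤ Real.log b / (l + L) + l * (Real.log CT + D) / L := by
    rw [← sub_le_iff_le_add', div_sub_div _ _ hL0.ne' (by positivity),
      div_le_div_iff₀ (by positivity) hL0]
    have : Real.log b ≤ (Real.log CT + D) * (l + L) := by
      nlinarith
    have h2 := mul_le_mul_of_nonneg_left this (show 0 ≤ l * L by positivity)
    nlinarith
  have e4 : Real.log a / L ≤ (Real.log C + 2 * Real.log L) / L + Real.log b / L := by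
    rw [← add_div]
    push_cast at e1
    gcongr
  have e5 : (Real.log C + l * (Real.log CT + D) + 2 * Real.log L) / L =
    (Real.log C + 2 * Real.log L) / L + l * (Real.log CT + D) / L := by ring
  linarith

/-- Minkowski dimensions are monotone with respect to domination of packing numbers up to a factor
of order `(log ε⁻¹)²` and a factor `4` in the radius. -/
theorem minkowskiDim_le_of_eventually {S T : Set E} (hS : S.Nonempty)
    (hSb : Bornology.IsBounded S) (hT : T.Nonempty) (hTb : Bornology.IsBounded T) {C : ℝ}
    (hC : 0 < C)
    (h : ∀ᶠ ε : ℝ in 𝓝[>] 0, ∀ a b : ℕ, ballPackingNumber S ε = a →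
      ballPackingNumber T (4⁻¹ * ε) = b → (a : ℝ) ≤ C * Real.log ε⁻¹ ^ 2 * b) :
    lowerMinkowskiDim S ≤ lowerMinkowskiDim T ∧ upperMinkowskiDim S ≤ upperMinkowskiDim T := by
  have hev := fun η (hη : (0 : ℝ) < η) ↦ eventually_packingExponent_le hS hSb hT hTb hC h hη
  have hmap := map_mul_left_nhdsGT_zero (c := 4⁻¹) (by norm_num)
  have hlim : liminf (fun ε ↦ packingExponent T (4⁻¹ * ε)) (𝓝[>] 0) = lowerMinkowskiDim T := by
    conv_rhs => rw [lowerMinkowskiDim, ← hmap, liminf, map_map]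
    rfl
  have hlim' : limsup (fun ε ↦ packingExponent T (4⁻¹ * ε)) (𝓝[>] 0) = upperMinkowskiDim T := by
    conv_rhs => rw [upperMinkowskiDim, ← hmap, limsup, map_map]
    rfl
  have hle : ∀ x y : EReal, (∀ η : ℝ, 0 < η → y ≤ (η : EReal) + x) → y ≤ x := by
    intro x y hxy
    refine EReal.le_of_forall_lt_iff_le.1 fun z hz ↦ ?_
    induction x with
    | bot => exact (hxy 1 one_pos).trans (by simp)
    | top => exact (not_top_lt hz).elim
    | coe x =>
      have hz : x < z := by exact_mod_cast hz
      refine (hxy (z - x) (sub_pos.2 hz)).trans ?_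
      rw [← EReal.coe_add, sub_add_cancel]
  refine ⟨hle _ _ fun η hη ↦ ?_, hle _ _ fun η hη ↦ ?_⟩
  · rw [← hlim]
    have h1 : limsup (fun _ : ℝ ↦ (η : EReal)) (𝓝[>] 0) = η := limsup_const _
    refine (liminf_le_liminf ((hev η hη).mono fun ε hε ↦ hε.trans (add_comm _ _).le)).trans ?_
    refine (EReal.liminf_add_le (.inl ?_) (.inl ?_)).trans ?_ <;> rw [h1] <;> simp
  · rw [← hlim']
    have h1 : limsup (fun _ : ℝ ↦ (η : EReal)) (𝓝[>] 0) = η := limsup_const _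
    refine (limsup_le_limsup ((hev η hη).mono fun ε hε ↦ hε.trans (add_comm _ _).le)).trans ?_
    refine (EReal.limsup_add_le (.inl ?_) (.inl ?_)).trans ?_ <;> rw [h1] <;> simp

/-- The dimensions of a bounded set are finite, as its packing number lies between `1` and a
multiple of `ε⁻ᵈ`. -/
theorem exists_coe_eq_minkowskiDim {S : Set E} (hS : S.Nonempty) (hSb : Bornology.IsBounded S) :
    ∃ c₁ c₂ : ℝ, lowerMinkowskiDim S = c₁ ∧ upperMinkowskiDim S = c₂ := by
  obtain ⟨C, hC1, hC⟩ := exists_ballPackingNumber_le hSb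
  set D : ℕ := Module.finrank ℝ E
  have hb : ∀ᶠ ε : ℝ in 𝓝[>] 0, (0 : EReal) ≤ packingExponent S ε ∧
      packingExponent S ε ≤ ((Real.log C + D : ℝ) : EReal) := by
    filter_upwards [Ioc_mem_nhdsGT one_pos, tendsto_log_inv_nhdsGT_zero.eventually
      (eventually_ge_atTop 1)] with ε ⟨hε0, hε1⟩ hL
    obtain ⟨n, hn, hnC⟩ := hC ε hε0 hε1
    have hn1 : 1 ≤ n := by exact_mod_cast hn ▸ one_le_ballPackingNumber (ε := ε) hS
    have hn1' : (1 : ℝ) ≤ n := by exact_mod_cast hn1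
    have e := Real.log_le_log (by linarith) hnC
    rw [Real.log_mul (by positivity) (by positivity), Real.log_pow] at e
    rw [packingExponent_eq hn hn1, ← EReal.coe_zero, EReal.coe_le_coe_iff, EReal.coe_le_coe_iff,
      div_le_iff₀ (by linarith)]
    exact ⟨div_nonneg (Real.log_nonneg hn1') (by linarith), by nlinarith [Real.log_nonneg hC1]⟩
  have key : ∀ x : EReal, 0 ≤ x → x ≤ ((Real.log C + D : ℝ) : EReal) → ∃ c : ℝ, x = c :=
    fun x h0 h1 ↦ ⟨x.toReal, (EReal.coe_toReal (h1.trans_lt (EReal.coe_lt_top _)).ne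
      (lt_of_lt_of_le (EReal.bot_lt_coe 0) h0).ne').symm⟩
  obtain ⟨c₁, h₁⟩ := key (lowerMinkowskiDim S)
    (le_liminf_of_le (by isBoundedDefault) (hb.mono fun _ h ↦ h.1))
    (liminf_le_of_frequently_le' (hb.mono fun _ h ↦ h.2).frequently)
  obtain ⟨c₂, h₂⟩ := key (upperMinkowskiDim S)
    (le_limsup_of_frequently_le' (hb.mono fun _ h ↦ h.1).frequently)
    (limsup_le_of_le (by isBoundedDefault) (hb.mono fun _ h ↦ h.2))
  exact ⟨c₁, c₂, h₁, h₂⟩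

end Dimension

/-! ### Concentration for subadditive functionals of independent pieces -/

section Concentration

variable {Ω : Type*} {mΩ : MeasurableSpace Ω}

/-- A monotone subadditive family of counts `N i j`, indexed by the integer intervals `[i, j)`.
The count `N i j` depends only on the information `𝒢 i j` of its interval, and consecutive
intervals carry independent information. -/
structure IsIndepCount (𝒢 : ℕ → ℕ → MeasurableSpace Ω) (N : ℕ → ℕ → Ω → ℕ∞)
    (P : Measure Ω) : Prop where
  le : ∀ i j, 𝒢 i j ≤ mΩ
  mono_info : ∀ {i i' j j'}, i' ≤ i → j ≤ j' → 𝒢 i j ≤ 𝒢 i' j'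
  indep : ∀ {i j k}, i ≤ j → j ≤ k → Indep (𝒢 i j) (𝒢 j k) P
  meas : ∀ i j (m : ℕ), MeasurableSet[𝒢 i j] {ω | (m : ℕ∞) ≤ N i j ω}
  mono : ∀ {i i' j j'}, i' ≤ i → j ≤ j' → ∀ ω, N i j ω ≤ N i' j' ω
  add_le : ∀ {i j k}, i ≤ j → j ≤ k → ∀ ω, N i k ω ≤ N i j ω + N j k ω
  self : ∀ i ω, N i i ω = 0

/-- The event that each single piece of `[i, j)` has count at most one. -/
def unitPieces (N : ℕ → ℕ → Ω → ℕ∞) (i j : ℕ) : Set Ω :=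
  {ω | ∀ l, i ≤ l → l < j → N l (l + 1) ω ≤ 1}

theorem unitPieces_subset (N : ℕ → ℕ → Ω → ℕ∞) {i i' j j' : ℕ} (hi : i' ≤ i) (hj : j ≤ j') :
    unitPieces N i' j' ⊆ unitPieces N i j :=
  fun _ h l hl hl' ↦ h l (hi.trans hl) (hl'.trans_le hj)

/-- If a total of at least `s` splits into a count below `m`, a single piece of count at most one,
and a rest, then the rest is at least `s - m - 1`. -/
theorem natCast_le_of_add_le {a b c : ℕ∞} {r s m : ℕ} (hr : r + m + 1 ≤ s)
    (hs : (s : ℕ∞) ≤ a + b + c) (ha : ¬ (m : ℕ∞) ≤ a) (hb : b ≤ 1) : (r : ℕ∞) ≤ c := by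
  induction c using ENat.recTopCoe with
  | top => simp
  | coe c =>
    lift a to ℕ using (not_le.1 ha).ne_top
    lift b to ℕ using (hb.trans_lt (ENat.natCast_lt_top 1)).ne
    norm_cast at *
    omega

namespace IsIndepCount

variable {𝒢 : ℕ → ℕ → MeasurableSpace Ω} {N : ℕ → ℕ → Ω → ℕ∞} {P : Measure Ω}

theorem measurableSet_unitPieces (h : IsIndepCount 𝒢 N P) (i j : ℕ) :
    MeasurableSet[𝒢 i j] (unitPieces N i j) := by
  have : unitPieces N i j =
      ⋂ l, ⋂ (_ : i ≤ l), ⋂ (_ : l < j), {ω | ((2 : ℕ) : ℕ∞) ≤ N l (l + 1) ω}ᶜ := by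
    ext ω
    simp only [unitPieces, Set.mem_ofPred_eq, Set.mem_iInter, Set.mem_compl_iff, not_le]
    refine forall₃_congr fun l _ _ ↦ ?_
    rw [show ((2 : ℕ) : ℕ∞) = 1 + 1 by norm_num, ENat.lt_add_one_iff (by simp)]
  rw [this]
  refine MeasurableSet.iInter fun l ↦ MeasurableSet.iInter fun hl ↦
    MeasurableSet.iInter fun hl' ↦ ?_
  exact (h.mono_info hl hl' _ (h.meas l (l + 1) 2)).compl

/-- Exponential tails: if `[a, b)` reaches `m` with probability at most `1 / 2`, then reaching a
`k`-fold multiple of `m + 1` has probability at most `2⁻ᵏ`. At the first index `j` where the count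
of `[i, j + 1)` reaches `m`, what remains is the count of `[j + 1, b)`, which is independent of
the past and dominated by that of `[a, b)`. -/
theorem measure_mul_le (h : IsIndepCount 𝒢 N P) [IsProbabilityMeasure P] {m a b : ℕ} (hm : 1 ≤ m)
    (hab : P {ω | (m : ℕ∞) ≤ N a b ω} ≤ 2⁻¹) (k : ℕ) : ∀ i, a ≤ i → i ≤ b →
    P ({ω | ((k * (m + 1) : ℕ) : ℕ∞) ≤ N i b ω} ∩ unitPieces N i b) ≤ 2⁻¹ ^ k := by
  induction k with
  | zero => exact fun i _ _ ↦ by simpa using prob_le_one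
  | succ k ih =>
    intro i hai hib
    -- `T j`: the level `m` is first reached with the piece `j`; `F j`: the rest `[j, b)` is large
    let F : ℕ → Set Ω := fun j ↦ {ω | ((k * (m + 1) : ℕ) : ℕ∞) ≤ N j b ω} ∩ unitPieces N j b
    let T : ℕ → Set Ω := fun j ↦ {ω | (m : ℕ∞) ≤ N i (j + 1) ω} \ {ω | (m : ℕ∞) ≤ N i j ω}
    have hT : ∀ j, i ≤ j → MeasurableSet[𝒢 i (j + 1)] (T j) := fun j hj ↦
      (h.meas i (j + 1) m).diff (h.mono_info le_rfl (Nat.le_succ j) _ (h.meas i j m))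
    have hF : ∀ j, MeasurableSet[𝒢 j b] (F j) := fun j ↦
      (h.meas j b _).inter (h.measurableSet_unitPieces j b)
    have hcover : {ω | (((k + 1) * (m + 1) : ℕ) : ℕ∞) ≤ N i b ω} ∩ unitPieces N i b ⊆
        ⋃ j ∈ Finset.Ico i b, T j ∩ F (j + 1) := by
      rintro ω ⟨hω, hG⟩
      have hex : ∃ j, i ≤ j ∧ (m : ℕ∞) ≤ N i j ω := by
        refine ⟨b, hib, le_trans ?_ hω⟩
        exact_mod_cast (by nlinarith : m ≤ (k + 1) * (m + 1))
      classical
      obtain ⟨hij, hmj⟩ := Nat.find_spec hex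
      have hmin := fun l hl ↦ Nat.find_min hex (m := l) hl
      have hjb : Nat.find hex ≤ b := Nat.find_min' hex ⟨hib, le_trans
        (by exact_mod_cast (by nlinarith : m ≤ (k + 1) * (m + 1))) hω⟩
      generalize Nat.find hex = j at hij hmj hmin hjb
      obtain rfl | hlt := hij.eq_or_lt
      · rw [h.self] at hmj
        have : m ≤ 0 := by exact_mod_cast hmj
        omega
      obtain ⟨j, rfl⟩ : ∃ j', j = j' + 1 := ⟨j - 1, by omega⟩
      have hnot : ¬ (m : ℕ∞) ≤ N i j ω := fun hc ↦ hmin j (Nat.lt_succ_self j) ⟨by omega, hc⟩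
      simp only [Set.mem_iUnion, Finset.mem_Ico]
      refine ⟨j, ⟨by omega, by omega⟩, ⟨hmj, hnot⟩, ?_, unitPieces_subset N (by omega) le_rfl hG⟩
      refine natCast_le_of_add_le (s := (k + 1) * (m + 1)) (le_of_eq (by ring)) ?_ hnot
        (hG j (by omega) (by omega))
      refine hω.trans ((h.add_le (j := j + 1) (by omega) hjb ω).trans ?_)
      gcongr
      exact h.add_le (by omega) (by omega) ω
    have hdisj : Set.PairwiseDisjoint (↑(Finset.Ico i b)) T := by
      have key : ∀ j j', j < j' → Disjoint (T j) (T j') := fun j j' hjj ↦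
        Set.disjoint_left.2 fun ω hω hω' ↦ hω'.2 (le_trans hω.1 (h.mono le_rfl (by omega) ω))
      intro j _ j' _ hne
      rcases lt_or_gt_of_ne hne with hl | hl
      · exact key j j' hl
      · exact (key j' j hl).symm
    calc _ ≤ P (⋃ j ∈ Finset.Ico i b, T j ∩ F (j + 1)) := measure_mono hcover
      _ ≤ ∑ j ∈ Finset.Ico i b, P (T j ∩ F (j + 1)) := measure_biUnion_finset_le _ _
      _ ≤ ∑ j ∈ Finset.Ico i b, P (T j) * 2⁻¹ ^ k := by
        refine Finset.sum_le_sum fun j hj ↦ ?_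
        rw [Finset.mem_Ico] at hj
        rw [(Indep_iff _ _ _).1 (h.indep (i := i) (j := j + 1) (k := b) (by omega) (by omega))
          _ _ (hT j hj.1) (hF (j + 1))]
        gcongr
        exact ih (j + 1) (by omega) (by omega)
      _ = P (⋃ j ∈ Finset.Ico i b, T j) * 2⁻¹ ^ k := by
        rw [← Finset.sum_mul, measure_biUnion_finset hdisj
          fun j hj ↦ h.le _ _ _ (hT j (Finset.mem_Ico.1 hj).1)]
      _ ≤ 2⁻¹ * 2⁻¹ ^ k := by
        gcongr
        refine (measure_mono ?_).trans hab
        simp only [Set.iUnion_subset_iff, Finset.mem_Ico]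
        exact fun j hj ω hω ↦ le_trans hω.1 (h.mono hai (by omega) ω)
      _ = 2⁻¹ ^ (k + 1) := by rw [pow_succ']

/-- Dichotomy for a threshold `m`: cut `[i, n)` greedily into blocks that reach `m` with
probability more than `1 / 2`. If there are `K` of them, then one of them reaches `m` except with
probability `2⁻ᴷ`; otherwise the total is a sum of fewer than `K` counts with exponential
tails. -/
theorem measure_lt_le_or (h : IsIndepCount 𝒢 N P) [IsProbabilityMeasure P] {m : ℕ} (hm : 1 ≤ m)
    (n k K : ℕ) : ∀ i ≤ n, P {ω | (m : ℕ∞) ≤ N i n ω}ᶜ ≤ 2⁻¹ ^ K ∨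
      P ({ω | ((K * ((k + 1) * (m + 1)) : ℕ) : ℕ∞) ≤ N i n ω} ∩ unitPieces N i n)
        ≤ K * 2⁻¹ ^ k := by
  induction K with
  | zero => exact fun i _ ↦ .inl (by simpa using prob_le_one)
  | succ K ih =>
    intro i hin
    by_cases hhalf : P {ω | (m : ℕ∞) ≤ N i n ω} ≤ 2⁻¹
    · right
      have hsub : {ω | (((K + 1) * ((k + 1) * (m + 1)) : ℕ) : ℕ∞) ≤ N i n ω} ⊆
          {ω | ((k * (m + 1) : ℕ) : ℕ∞) ≤ N i n ω} := fun ω hω ↦ by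
        have hω : _ ≤ N i n ω := hω
        refine le_trans ?_ hω
        exact_mod_cast (by nlinarith [Nat.zero_le (K * ((k + 1) * (m + 1)))] :
          k * (m + 1) ≤ (K + 1) * ((k + 1) * (m + 1)))
      refine (measure_mono (Set.inter_subset_inter_left _ hsub)).trans
        ((h.measure_mul_le hm hhalf k i le_rfl hin).trans ?_)
      exact le_mul_of_one_le_left' (by exact_mod_cast Nat.succ_le_succ (Nat.zero_le K))
    -- the first block `[i, j)` that reaches `m` with probability more than `1 / 2`
    have hex : ∃ j, i ≤ j ∧ ¬ P {ω | (m : ℕ∞) ≤ N i j ω} ≤ 2⁻¹ := ⟨n, hin, hhalf⟩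
    classical
    obtain ⟨hij, hj⟩ := Nat.find_spec hex
    have hmin := fun l hl ↦ Nat.find_min hex (m := l) hl
    have hjn : Nat.find hex ≤ n := Nat.find_min' hex ⟨hin, hhalf⟩
    generalize Nat.find hex = j at hij hj hmin hjn
    obtain rfl | hlt := hij.eq_or_lt
    · refine absurd ?_ hj
      simp [h.self, show m ≠ 0 by omega]
    obtain ⟨j, rfl⟩ : ∃ j', j = j' + 1 := ⟨j - 1, by omega⟩
    have hsmall : P {ω | (m : ℕ∞) ≤ N i j ω} ≤ 2⁻¹ := by
      by_contra hc
      exact hmin j (Nat.lt_succ_self j) ⟨by omega, hc⟩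
    rcases ih (j + 1) hjn with hleft | hright
    · left
      have hsub : {ω | (m : ℕ∞) ≤ N i n ω}ᶜ ⊆
          {ω | (m : ℕ∞) ≤ N i (j + 1) ω}ᶜ ∩ {ω | (m : ℕ∞) ≤ N (j + 1) n ω}ᶜ := fun ω hω ↦
        ⟨fun hc ↦ hω (le_trans hc (h.mono le_rfl hjn ω)),
          fun hc ↦ hω (le_trans hc (h.mono (by omega) le_rfl ω))⟩
      refine (measure_mono hsub).trans ?_
      rw [(Indep_iff _ _ _).1 (h.indep (i := i) (j := j + 1) (k := n) (by omega) hjn)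
        _ _ (h.meas _ _ _).compl (h.meas _ _ _).compl, pow_succ']
      gcongr
      rw [prob_compl_eq_one_sub (h.le _ _ _ (h.meas _ _ _)), ← ENNReal.one_sub_inv_two]
      exact tsub_le_tsub_left (not_le.1 hj).le _
    · right
      have hsub : {ω | (((K + 1) * ((k + 1) * (m + 1)) : ℕ) : ℕ∞) ≤ N i n ω} ∩ unitPieces N i n ⊆
          ({ω | ((k * (m + 1) : ℕ) : ℕ∞) ≤ N i j ω} ∩ unitPieces N i j) ∪
          ({ω | ((K * ((k + 1) * (m + 1)) : ℕ) : ℕ∞) ≤ N (j + 1) n ω} ∩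
            unitPieces N (j + 1) n) := by
        rintro ω ⟨hω, hG⟩
        by_cases hc : ((k * (m + 1) : ℕ) : ℕ∞) ≤ N i j ω
        · exact .inl ⟨hc, unitPieces_subset N le_rfl (by omega) hG⟩
        refine .inr ⟨?_, unitPieces_subset N (by omega) le_rfl hG⟩
        refine natCast_le_of_add_le (s := (K + 1) * ((k + 1) * (m + 1))) ?_ ?_ hc
          (hG j (by omega) (by omega))
        · nlinarith
        refine le_trans hω ((h.add_le (j := j + 1) (by omega) hjn ω).trans ?_)
        gcongr
        exact h.add_le (by omega) (by omega) ω
      calc _ ≤ _ := measure_mono hsub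
        _ ≤ _ := measure_union_le _ _
        _ ≤ 2⁻¹ ^ k + K * 2⁻¹ ^ k :=
          add_le_add (h.measure_mul_le hm hsmall k i le_rfl (by omega)) hright
        _ = _ := by push_cast; ring

end IsIndepCount

end Concentration

/-! ### Partitions of the unit interval adapted to a càdlàg function -/

section Partition

/-- A càdlàg function on the unit interval has small oscillation between nearby times that are not
separated by one of finitely many times. -/
theorem IsCadlag.exists_finset_dist_lt {E : Type*} [PseudoMetricSpace E] {f : unitInterval → E}
    (hf : IsCadlag f) {ε : ℝ} (hε : 0 < ε) :
    ∃ (F : Finset unitInterval) (η : ℝ), 0 < η ∧ ∀ s t, s ≤ t → dist s t < η →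
      (∀ c ∈ F, c ≤ t → c ≤ s) → dist (f s) (f t) < ε := by
  have key : ∀ c : unitInterval, ∃ U : Set unitInterval, IsOpen U ∧ c ∈ U ∧
      (∀ s ∈ U, ∀ t ∈ U, (c ≤ s ∧ c ≤ t ∨ s < c ∧ t < c) → dist (f s) (f t) < ε) := by
    intro c
    obtain ⟨hr, l, hl⟩ := hf c
    have h1 : ∀ᶠ x in 𝓝 c, c ≤ x → dist (f x) (f c) < ε / 2 :=
      eventually_nhdsWithin_iff.1 (hr.eventually (Metric.ball_mem_nhds (f c) (half_pos hε)))
    have h2 : ∀ᶠ x in 𝓝 c, x < c → dist (f x) l < ε / 2 :=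
      eventually_nhdsWithin_iff.1 (hl.eventually (Metric.ball_mem_nhds l (half_pos hε)))
    obtain ⟨U, hU, hUo, hcU⟩ := mem_nhds_iff.1 (h1.and h2)
    refine ⟨U, hUo, hcU, fun s hs t ht hst ↦ ?_⟩
    rcases hst with ⟨h, h'⟩ | ⟨h, h'⟩
    · linarith [dist_triangle_right (f s) (f t) (f c), (hU hs).1 h, (hU ht).1 h']
    · linarith [dist_triangle_right (f s) (f t) l, (hU hs).2 h, (hU ht).2 h']
  choose U hUo hcU hU using key
  obtain ⟨F, hF⟩ := isCompact_univ.elim_finite_subcover U hUo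
    fun c _ ↦ Set.mem_iUnion.2 ⟨c, hcU c⟩
  obtain ⟨η, hη, hball⟩ := lebesgue_number_lemma_of_metric (c := fun c : F ↦ U c)
    isCompact_univ (fun c ↦ hUo c) (by rwa [Set.iUnion_subtype])
  refine ⟨F, η, hη, fun s t hst hd hsep ↦ ?_⟩
  obtain ⟨⟨c, hc⟩, hsub⟩ := hball s (Set.mem_univ s)
  refine hU c s (hsub (Metric.mem_ball_self hη)) t (hsub (by rwa [Metric.mem_ball, dist_comm])) ?_
  rcases le_or_gt c t with h | h
  · exact .inl ⟨hsep c hc h, h⟩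
  · exact .inr ⟨hst.trans_lt h, h⟩

/-- The index of the piece containing `t` when the unit interval is cut at the times in `F` and at
the multiples of `1 / M`. -/
noncomputable def pieceIndex (F : Finset unitInterval) (M : ℕ) (t : unitInterval) : ℕ :=
  (F.filter (· ≤ t)).card + ⌊(M : ℝ) * t⌋₊

theorem pieceIndex_monotone (F : Finset unitInterval) (M : ℕ) : Monotone (pieceIndex F M) := by
  intro s t hst
  refine add_le_add (Finset.card_le_card fun c hc ↦ ?_) (Nat.floor_le_floor ?_)
  · rw [Finset.mem_filter] at hc ⊢
    exact ⟨hc.1, hc.2.trans hst⟩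
  · exact mul_le_mul_of_nonneg_left hst (Nat.cast_nonneg M)

theorem pieceIndex_lt (F : Finset unitInterval) (M : ℕ) (t : unitInterval) :
    pieceIndex F M t < F.card + M + 1 := by
  have h1 : (F.filter (· ≤ t)).card ≤ F.card := Finset.card_filter_le _ _
  have h2 : ⌊(M : ℝ) * t⌋₊ ≤ M :=
    Nat.floor_le_of_le (mul_le_of_le_one_right (Nat.cast_nonneg M) t.2.2)
  unfold pieceIndex
  omega

theorem of_pieceIndex_eq {F : Finset unitInterval} {M : ℕ} (hM : 0 < M) {s t : unitInterval}
    (hst : s ≤ t) (h : pieceIndex F M s = pieceIndex F M t) :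
    dist s t < 1 / M ∧ ∀ c ∈ F, c ≤ t → c ≤ s := by
  have hM' : (0 : ℝ) < M := Nat.cast_pos.2 hM
  have hsub : F.filter (· ≤ s) ⊆ F.filter (· ≤ t) := fun c hc ↦ by
    rw [Finset.mem_filter] at hc ⊢
    exact ⟨hc.1, hc.2.trans hst⟩
  have h1 := Finset.card_le_card hsub
  have hst' : (s : ℝ) ≤ t := hst
  have h2 : ⌊(M : ℝ) * s⌋₊ ≤ ⌊(M : ℝ) * t⌋₊ :=
    Nat.floor_le_floor (mul_le_mul_of_nonneg_left hst' hM'.le)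
  unfold pieceIndex at h
  have h3 : ⌊(M : ℝ) * s⌋₊ = ⌊(M : ℝ) * t⌋₊ := by omega
  refine ⟨?_, fun c hc hct ↦ ?_⟩
  · have h4 := Nat.floor_le (mul_nonneg hM'.le s.2.1)
    have h5 := Nat.lt_floor_add_one ((M : ℝ) * t)
    rw [← h3] at h5
    rw [Subtype.dist_eq, dist_comm, Real.dist_eq, abs_of_nonneg (by linarith), lt_div_iff₀ hM']
    linarith
  · have h4 := Finset.eq_of_subset_of_card_le hsub (by omega)
    have : c ∈ F.filter (· ≤ t) := Finset.mem_filter.2 ⟨hc, hct⟩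
    rw [← h4] at this
    exact (Finset.mem_filter.1 this).2

variable {E : Type*} [SeminormedAddCommGroup E]

/-- Partitions of the unit interval, finer and finer, on whose pieces the sum of a given càdlàg
function and any continuous function eventually oscillates by less than `ε`. -/
theorem IsCadlag.exists_pieces {f : unitInterval → E} (hf : IsCadlag f) {ε : ℝ} (hε : 0 < ε) :
    ∃ F : Finset unitInterval, ∀ w : unitInterval → E, Continuous w → ∀ᶠ M in atTop,
      ∀ s t, pieceIndex F M s = pieceIndex F M t → dist (w s + f s) (w t + f t) < ε := by
  obtain ⟨F, η, hη, hF⟩ := hf.exists_finset_dist_lt (half_pos hε)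
  refine ⟨F, fun w hw ↦ ?_⟩
  obtain ⟨δ, hδ, hw⟩ := Metric.uniformContinuous_iff.1
    (CompactSpace.uniformContinuous_of_continuous hw) (ε / 2) (half_pos hε)
  have hlim := (tendsto_one_div_atTop_nhds_zero_nat (𝕜 := ℝ)).eventually
    (gt_mem_nhds (lt_min hη hδ))
  filter_upwards [hlim, eventually_gt_atTop 0] with M hM hM0
  have key : ∀ s t, s ≤ t → pieceIndex F M s = pieceIndex F M t →
      dist (w s + f s) (w t + f t) < ε := by
    intro s t hst h
    obtain ⟨h1, h2⟩ := of_pieceIndex_eq hM0 hst h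
    have h3 := hF s t hst ((h1.trans hM).trans_le (min_le_left _ _)) h2
    have h4 := hw ((h1.trans hM).trans_le (min_le_right _ _))
    linarith [dist_add_add_le (w s) (f s) (w t) (f t)]
  intro s t h
  rcases le_total s t with hst | hst
  · exact key s t hst h
  · rw [dist_comm]
    exact key t s hst h.symm

theorem IsCadlag.isBounded_range_add {f w : unitInterval → E} (hf : IsCadlag f)
    (hw : Continuous w) : Bornology.IsBounded (Set.range fun t ↦ w t + f t) := by
  obtain ⟨F, hF⟩ := hf.exists_pieces one_pos
  obtain ⟨M, hM⟩ := (hF w hw).exists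
  have hsub : (Set.range fun t ↦ w t + f t) ⊆ ⋃ k ∈ Set.Iio (F.card + M + 1),
      (fun t ↦ w t + f t) '' {t | pieceIndex F M t = k} := by
    rintro _ ⟨t, rfl⟩
    exact Set.mem_biUnion (pieceIndex_lt F M t) (Set.mem_image_of_mem _ rfl)
  refine ((Bornology.isBounded_biUnion (Set.finite_Iio _)).2 fun k _ ↦ ?_).subset hsub
  refine Metric.isBounded_iff.2 ⟨1, ?_⟩
  rintro _ ⟨s, hs : _ = k, rfl⟩ _ ⟨t, ht : _ = k, rfl⟩
  exact (hM s t (hs.trans ht.symm)).le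

/-- Whatever the function `f`, a set of times contains a countable set that is dense in it for the
topology of the graph of `f`. -/
theorem exists_countable_forall_mem_closure_image {T E : Type*} [TopologicalSpace T]
    [SecondCountableTopology T] [TopologicalSpace E] [SecondCountableTopology E] [Add E]
    [ContinuousAdd E] (f : T → E) (A : Set T) :
    ∃ A' ⊆ A, A'.Countable ∧ ∀ w : T → E, Continuous w →
      (fun t ↦ w t + f t) '' A ⊆ closure ((fun t ↦ w t + f t) '' A') := by
  let G : T → T × E := fun t ↦ (t, f t)
  obtain ⟨D, hDc, hD⟩ := TopologicalSpace.exists_countable_dense (G '' A)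
  refine ⟨(fun p : G '' A ↦ p.1.1) '' D, ?_, hDc.image _, fun w hw ↦ ?_⟩
  · rintro _ ⟨⟨_, t, ht, rfl⟩, -, rfl⟩
    exact ht
  have hcont : Continuous fun p : G '' A ↦ w p.1.1 + p.1.2 := by fun_prop
  rintro _ ⟨t, ht, rfl⟩
  have hmem := map_mem_closure hcont (hD ⟨G t, t, ht, rfl⟩) (Set.mapsTo_image _ D)
  refine closure_mono ?_ hmem
  rintro _ ⟨⟨_, s, hs, rfl⟩, hsD, rfl⟩
  exact ⟨s, ⟨_, hsD, rfl⟩, rfl⟩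

end Partition

/-! ### Independence of the increments of a Brownian motion -/

section Increments

variable {Ω : Type*} {mΩ : MeasurableSpace Ω} {d : ℕ} {W : ℝ≥0 → Ω → EuclideanSpace ℝ (Fin d)}
  {P : Measure Ω}

/-- The information carried by the increments of the process `W` between times of `T`. -/
abbrev incrementInfo (W : ℝ≥0 → Ω → EuclideanSpace ℝ (Fin d)) (T : Set ℝ≥0) : MeasurableSpace Ω :=
  ⨆ (s ∈ T) (t ∈ T), MeasurableSpace.comap (fun ω ↦ W s ω - W t ω) inferInstance

theorem measurable_incrementInfo {T : Set ℝ≥0} {s t : ℝ≥0} (hs : s ∈ T) (ht : t ∈ T) :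
    Measurable[incrementInfo W T] fun ω ↦ W s ω - W t ω :=
  Measurable.of_comap_le (le_iSup₂_of_le s hs (le_iSup₂_of_le t ht le_rfl))

theorem incrementInfo_le {T : Set ℝ≥0} {m : MeasurableSpace Ω}
    (h : ∀ s ∈ T, ∀ t ∈ T, Measurable[m] fun ω ↦ W s ω - W t ω) : incrementInfo W T ≤ m :=
  iSup₂_le fun s hs ↦ iSup₂_le fun t ht ↦ (h s hs t ht).comap_le

theorem incrementInfo_mono {T T' : Set ℝ≥0} (h : T ⊆ T') :
    incrementInfo W T ≤ incrementInfo W T' :=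
  incrementInfo_le fun _ hs _ ht ↦ measurable_incrementInfo (h hs) (h ht)

theorem measurable_of_forall_coord {m : MeasurableSpace Ω} {g : Ω → EuclideanSpace ℝ (Fin d)}
    (h : ∀ i, Measurable[m] fun ω ↦ g ω i) : Measurable[m] g :=
  (MeasurableEquiv.toLp 2 (Fin d → ℝ)).measurable.comp (measurable_pi_lambda _ h)

/-- Increments before a time `u` are independent of increments after it. For each coordinate this
is the Markov property; the coordinates are combined by regrouping an independent family. -/
theorem indep_incrementInfo (hW : ∀ t, Measurable (W t))
    (hB : ∀ i, IsPreBrownianReal (fun t ω ↦ W t ω i) P)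
    (hind : iIndepFun (fun (i : Fin d) (ω : Ω) (t : ℝ≥0) ↦ W t ω i) P) {u : ℝ≥0} {T T' : Set ℝ≥0}
    (hT : ∀ s ∈ T, s ≤ u) (hT' : ∀ t ∈ T', u ≤ t) :
    Indep (incrementInfo W T) (incrementInfo W T') P := by
  have hWi : ∀ t i, Measurable fun ω ↦ W t ω i := fun t i ↦
    (EuclideanSpace.proj (𝕜 := ℝ) i).continuous.measurable.comp (hW t)
  -- `φ false` is the path stopped at time `u`, `φ true` the path restarted at time `u`
  let φ : Bool → (ℝ≥0 → ℝ) → ℝ≥0 → ℝ := fun b x r ↦ cond b (x (u + r) - x u) (x (min r u))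
  have hφ : ∀ b, Measurable (φ b) := by
    intro b
    refine measurable_pi_lambda _ fun r ↦ ?_
    cases b
    · exact measurable_pi_apply _
    · exact (measurable_pi_apply _).sub (measurable_pi_apply _)
  let X : Fin d → Bool → Ω → ℝ≥0 → ℝ := fun i b ω ↦ φ b fun t ↦ W t ω i
  have hX : ∀ i b, Measurable (X i b) := fun i b ↦
    (hφ b).comp (measurable_pi_lambda _ fun t ↦ hWi t i)
  have h1 : iIndepFun (fun i ω ↦ (X i · ω)) P :=
    hind.comp (fun _ x b ↦ φ b x) fun _ ↦ measurable_pi_lambda _ hφ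
  have h2 : ∀ i, iIndepFun (X i) P := by
    intro i
    have h := (hB i).indepFun_shift u
    have h' : IndepFun (X i true) (X i false) P :=
      h.comp (φ := id) (ψ := fun (x : Set.Iic u → ℝ) r ↦ x ⟨min r u, min_le_right r u⟩)
        measurable_id (measurable_pi_lambda _ fun r ↦ measurable_pi_apply _)
    have := ((hB i).hasLaw_eval u).isProbabilityMeasure
    refine iIndepFun_iff_measure_inter_preimage_eq_mul.2 fun S sets hS ↦ ?_
    have hcases : ∀ S : Finset Bool, S = ∅ ∨ S = {true} ∨ S = {false} ∨ S = {true, false} := by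
      decide
    rcases hcases S with rfl | rfl | rfl | rfl
    · simp
    · simp
    · simp
    · rw [Finset.prod_pair (by simp), Finset.set_biInter_insert, Finset.set_biInter_singleton]
      exact h'.measure_inter_preimage_eq_mul _ _ (hS true (by simp)) (hS false (by simp))
  have h3 := iIndepFun_uncurry' hX h1 h2
  have h4 := indep_iSup_of_disjoint (fun p : Fin d × Bool ↦ (hX p.1 p.2).comap_le) h3
    (S := {p | p.2 = false}) (T := {p | p.2 = true})
    (Set.disjoint_left.2 fun p hp hp' ↦ by simp_all)
  refine indep_of_indep_of_le_left (indep_of_indep_of_le_right h4 ?_) ?_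
  · refine incrementInfo_le fun s hs t ht ↦ measurable_of_forall_coord fun i ↦ ?_
    have hm : Measurable[⨆ p ∈ {p : Fin d × Bool | p.2 = true},
        MeasurableSpace.comap (X p.1 p.2) inferInstance] (X i true) :=
      Measurable.of_comap_le (le_iSup₂_of_le (i, true) rfl le_rfl)
    have hs' := (measurable_pi_apply (s - u)).comp hm
    have ht' := (measurable_pi_apply (t - u)).comp hm
    convert hs'.sub ht' using 1
    ext ω
    simp [X, φ, add_tsub_cancel_of_le (hT' s hs), add_tsub_cancel_of_le (hT' t ht)]
  · refine incrementInfo_le fun s hs t ht ↦ measurable_of_forall_coord fun i ↦ ?_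
    have hm : Measurable[⨆ p ∈ {p : Fin d × Bool | p.2 = false},
        MeasurableSpace.comap (X p.1 p.2) inferInstance] (X i false) :=
      Measurable.of_comap_le (le_iSup₂_of_le (i, false) rfl le_rfl)
    have hs' := (measurable_pi_apply s).comp hm
    have ht' := (measurable_pi_apply t).comp hm
    convert hs'.sub ht' using 1
    ext ω
    simp [X, φ, hT s hs, hT t ht]

end Increments

/-! ### Concentration of the packing numbers -/

section Image

variable {Ω : Type*} {d : ℕ} {W : ℝ≥0 → Ω → EuclideanSpace ℝ (Fin d)}
  {f : unitInterval → EuclideanSpace ℝ (Fin d)} {A : Set unitInterval} {ε : ℝ}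

/-- The image `(W + f)(A)` of the path of `W` at `ω`. -/
def driftImage (W : ℝ≥0 → Ω → EuclideanSpace ℝ (Fin d))
    (f : unitInterval → EuclideanSpace ℝ (Fin d)) (A : Set unitInterval) (ω : Ω) :
    Set (EuclideanSpace ℝ (Fin d)) :=
  (fun t ↦ W (unitInterval.toNNReal t) ω + f t) '' A

theorem measurableSet_le_ballPackingNumber_driftImage (hA : A.Countable) (hε : 0 < ε) (m : ℕ) :
    MeasurableSet[incrementInfo W (unitInterval.toNNReal '' A)]
      {ω | (m : ℕ∞) ≤ ballPackingNumber (driftImage W f A ω) ε} := by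
  have : {ω | (m : ℕ∞) ≤ ballPackingNumber (driftImage W f A ω) ε} =
      ⋃ t : Fin m → A, ⋂ i, ⋂ j, ⋂ (_ : i ≠ j), {ω | 2 * ε ≤ ‖W (unitInterval.toNNReal (t i)) ω -
        W (unitInterval.toNNReal (t j)) ω + (f (t i) - f (t j))‖} := by
    ext ω
    simp only [Set.mem_ofPred_eq, Set.mem_iUnion, Set.mem_iInter, le_ballPackingNumber_iff_dist hε,
      driftImage]
    constructor
    · rintro ⟨x, hx, hd⟩
      choose t htA ht using hx
      refine ⟨fun i ↦ ⟨t i, htA i⟩, fun i j hij ↦ ?_⟩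
      have h := hd hij
      simp only [← ht, dist_eq_norm] at h
      rwa [add_sub_add_comm] at h
    · rintro ⟨t, ht⟩
      refine ⟨_, fun i ↦ ⟨t i, (t i).2, rfl⟩, fun i j hij ↦ ?_⟩
      have h := ht i j hij
      simp only [dist_eq_norm]
      rwa [add_sub_add_comm]
  rw [this]
  have := hA.to_subtype
  let _ : MeasurableSpace Ω := incrementInfo W (unitInterval.toNNReal '' A)
  refine MeasurableSet.iUnion fun t ↦ MeasurableSet.iInter fun i ↦ MeasurableSet.iInter fun j ↦
    MeasurableSet.iInter fun _ ↦ ?_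
  refine measurableSet_le measurable_const (Measurable.norm (Measurable.add_const ?_ _))
  exact measurable_incrementInfo (Set.mem_image_of_mem _ (t i).2) (Set.mem_image_of_mem _ (t j).2)

/-- The packing numbers of the images of the pieces of a partition into consecutive pieces. -/
theorem isIndepCount_driftImage {mΩ : MeasurableSpace Ω} {P : Measure Ω}
    (hW : ∀ t, Measurable (W t))
    (hB : ∀ i, IsPreBrownianReal (fun t ω ↦ W t ω i) P)
    (hind : iIndepFun (fun (i : Fin d) (ω : Ω) (t : ℝ≥0) ↦ W t ω i) P)
    (hA : A.Countable) (hε : 0 < ε) {p : unitInterval → ℕ} (hp : Monotone p) :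
    IsIndepCount (fun i j ↦ incrementInfo W (unitInterval.toNNReal '' (A ∩ p ⁻¹' Set.Ico i j)))
      (fun i j ω ↦ ballPackingNumber (driftImage W f (A ∩ p ⁻¹' Set.Ico i j) ω) ε) P where
  le i j := incrementInfo_le fun s _ t _ ↦ (hW s).sub (hW t)
  mono_info hi hj := incrementInfo_mono (by gcongr)
  indep {i j k} hij hjk := by
    -- a time separating the pieces before `j` from the others
    let u : ℝ≥0 := sSup (unitInterval.toNNReal '' (p ⁻¹' Set.Iio j))
    refine indep_incrementInfo hW hB hind (u := u) ?_ ?_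
    · rintro _ ⟨s, ⟨-, hs⟩, rfl⟩
      refine le_csSup ⟨1, ?_⟩ (Set.mem_image_of_mem _ hs.2)
      rintro _ ⟨t, -, rfl⟩
      exact t.2.2
    · rintro _ ⟨t, ⟨-, ht⟩, rfl⟩
      refine csSup_le' ?_
      rintro _ ⟨s, hs, rfl⟩
      exact (hp.reflect_lt (lt_of_lt_of_le hs ht.1)).le
  meas i j m := measurableSet_le_ballPackingNumber_driftImage
    (hA.mono Set.inter_subset_left) hε m
  mono hi hj ω := ballPackingNumber_mono (by unfold driftImage; gcongr)
  add_le {i j k} hij hjk ω := by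
    rw [← Set.Ico_union_Ico_eq_Ico hij hjk, Set.preimage_union, Set.inter_union_distrib_left,
      driftImage, Set.image_union]
    exact ballPackingNumber_union_le
  self i ω := by simp [driftImage]

end Image

section ImageConcentration

variable {Ω : Type*} {mΩ : MeasurableSpace Ω} {d : ℕ} {W : ℝ≥0 → Ω → EuclideanSpace ℝ (Fin d)}
  {P : Measure Ω} [IsProbabilityMeasure P] {f : unitInterval → EuclideanSpace ℝ (Fin d)}
  {A : Set unitInterval} {ε : ℝ}

theorem driftImage_eq_image {ω : Ω} {w : unitInterval → EuclideanSpace ℝ (Fin d)}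
    (h : ∀ t ∈ A, W (unitInterval.toNNReal t) ω = w t) :
    driftImage W f A ω = (fun t ↦ w t + f t) '' A :=
  Set.image_congr fun t ht ↦ by rw [h t ht]

/-- The dichotomy for the packing number of `(W + f)(A)`, freed from the choice of a partition:
along finer and finer partitions, almost surely all pieces eventually have an image of diameter
less than `ε`. -/
theorem measure_ballPackingNumber_driftImage_lt_le_or (hW : ∀ t, Measurable (W t))
    (hB : ∀ i, IsPreBrownianReal (fun t ω ↦ W t ω i) P)
    (hind : iIndepFun (fun (i : Fin d) (ω : Ω) (t : ℝ≥0) ↦ W t ω i) P)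
    (hcont : ∀ᵐ ω ∂P, ∃ w : unitInterval → EuclideanSpace ℝ (Fin d), Continuous w ∧
      ∀ t ∈ A, W (unitInterval.toNNReal t) ω = w t)
    (hf : IsCadlag f) (hA : A.Countable) (hε : 0 < ε) {m : ℕ} (hm : 1 ≤ m) (k K : ℕ) :
    P {ω | (m : ℕ∞) ≤ ballPackingNumber (driftImage W f A ω) ε}ᶜ ≤ 2⁻¹ ^ K ∨
      P {ω | ((K * ((k + 1) * (m + 1)) : ℕ) : ℕ∞) ≤ ballPackingNumber (driftImage W f A ω) ε}
        ≤ K * 2⁻¹ ^ k := by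
  obtain ⟨F, hF⟩ := hf.exists_pieces hε
  let n : ℕ → ℕ := fun M ↦ F.card + M + 1
  let N : ℕ → ℕ → ℕ → Ω → ℕ∞ := fun M i j ω ↦
    ballPackingNumber (driftImage W f (A ∩ pieceIndex F M ⁻¹' Set.Ico i j) ω) ε
  have hcount := fun M ↦ isIndepCount_driftImage (f := f) hW hB hind hA hε
    (pieceIndex_monotone F M)
  have htot : ∀ M ω, N M 0 (n M) ω = ballPackingNumber (driftImage W f A ω) ε := by
    intro M ω
    have : A ∩ pieceIndex F M ⁻¹' Set.Ico 0 (n M) = A :=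
      Set.inter_eq_left.2 fun t _ ↦ ⟨Nat.zero_le _, pieceIndex_lt F M t⟩
    simp only [N, this]
  rw [or_iff_not_imp_left]
  intro hleft
  have hright : ∀ M, P ({ω | ((K * ((k + 1) * (m + 1)) : ℕ) : ℕ∞) ≤
      ballPackingNumber (driftImage W f A ω) ε} ∩ unitPieces (N M) 0 (n M)) ≤ K * 2⁻¹ ^ k := by
    intro M
    have h := (hcount M).measure_lt_le_or hm (n M) k K 0 (Nat.zero_le _)
    change P {ω | (m : ℕ∞) ≤ N M 0 (n M) ω}ᶜ ≤ _ ∨ P ({ω | _ ≤ N M 0 (n M) ω} ∩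
      unitPieces (N M) 0 (n M)) ≤ _ at h
    simp only [htot] at h
    exact h.resolve_left hleft
  have hunit : ∀ᵐ ω ∂P, ∀ᶠ M in atTop, ω ∈ unitPieces (N M) 0 (n M) := by
    filter_upwards [hcont] with ω ⟨w, hw, hwA⟩
    filter_upwards [hF w hw] with M hM l _ _
    refine ballPackingNumber_le_one ?_
    rintro _ ⟨s, ⟨hsA, hs⟩, rfl⟩ _ ⟨t, ⟨htA, ht⟩, rfl⟩
    simp only [hwA s hsA, hwA t htA]
    refine hM s t ?_
    rw [Set.mem_preimage, Set.mem_Ico] at hs ht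
    omega
  set G : Set Ω := {ω | ((K * ((k + 1) * (m + 1)) : ℕ) : ℕ∞) ≤
      ballPackingNumber (driftImage W f A ω) ε} with hG
  -- `D M` increases to `G` up to a null set, and has probability at most the bound of `hright`
  let D : ℕ → Set Ω := fun M ↦ {ω | ω ∈ G ∧ ∀ M' ≥ M, ω ∈ unitPieces (N M') 0 (n M')}
  have hD : Monotone D := fun M M' hMM ω hω ↦ ⟨hω.1, fun M'' h ↦ hω.2 M'' (le_trans hMM h)⟩
  calc P G ≤ P (⋃ M, D M) := by
        refine measure_mono_ae ?_
        filter_upwards [hunit] with ω hω hωG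
        obtain ⟨M, hM⟩ := eventually_atTop.1 hω
        exact Set.mem_iUnion.2 ⟨M, hωG, hM⟩
    _ = ⨆ M, P (D M) := hD.measure_iUnion
    _ ≤ _ := iSup_le fun M ↦ by
        refine (measure_mono ?_).trans (hright M)
        exact fun ω hω ↦ ⟨hω.1, hω.2 M le_rfl⟩

/-- Concentration: the packing number of `(W + f)(A)` lies in a deterministic interval, with
end points of ratio quadratic in `n`, except with probability of order `2⁻ⁿ`. The left end point
is the largest `m` which the packing number reaches with probability at least `1 - 2⁻ⁿ`. -/
theorem exists_ballPackingNumber_driftImage_concentrated (hW : ∀ t, Measurable (W t))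
    (hB : ∀ i, IsPreBrownianReal (fun t ω ↦ W t ω i) P)
    (hind : iIndepFun (fun (i : Fin d) (ω : Ω) (t : ℝ≥0) ↦ W t ω i) P)
    (hcont : ∀ᵐ ω ∂P, ∃ w : unitInterval → EuclideanSpace ℝ (Fin d), Continuous w ∧
      ∀ t ∈ A, W (unitInterval.toNNReal t) ω = w t)
    (hf : IsCadlag f) (hA : A.Countable) (hAne : A.Nonempty) (hε : 0 < ε) (n : ℕ) :
    ∃ m : ℕ, 1 ≤ m ∧
      P {ω | (m : ℕ∞) ≤ ballPackingNumber (driftImage W f A ω) ε}ᶜ ≤ 2⁻¹ ^ n ∧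
      P {ω | ((n * ((2 * n + 1) * (m + 2)) : ℕ) : ℕ∞) ≤
        ballPackingNumber (driftImage W f A ω) ε} ≤ 2⁻¹ ^ n := by
  rcases Nat.eq_zero_or_pos n with rfl | hn
  · exact ⟨1, le_rfl, by simpa using prob_le_one, by simp⟩
  let V : Ω → ℕ∞ := fun ω ↦ ballPackingNumber (driftImage W f A ω) ε
  have hfin : ∀ᵐ ω ∂P, V ω ≠ ⊤ := by
    filter_upwards [hcont] with ω ⟨w, hw, hwA⟩
    have hb : Bornology.IsBounded (driftImage W f A ω) := by
      rw [driftImage_eq_image hwA]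
      exact (hf.isBounded_range_add hw).subset (Set.image_subset_range _ _)
    obtain ⟨C, -, hC⟩ := exists_ballPackingNumber_le hb
    obtain ⟨l, hl, -⟩ := hC (min ε 1) (lt_min hε one_pos) (min_le_right _ _)
    exact ((ballPackingNumber_anti (min_le_left _ _)).trans_lt
      (hl ▸ ENat.natCast_lt_top l)).ne
  -- as `V` is almost surely finite, large levels are reached with small probability only
  have hex : ∃ m : ℕ, ¬ P {ω | (m : ℕ∞) ≤ V ω}ᶜ ≤ 2⁻¹ ^ n := by
    by_contra! hcon
    have hmono : Monotone fun m : ℕ ↦ {ω | (m : ℕ∞) ≤ V ω}ᶜ := by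
      intro m m' hmm ω hω hω'
      have hω' : (m' : ℕ∞) ≤ V ω := hω'
      exact hω (le_trans (Nat.cast_le.2 hmm) hω')
    have h1 : P (⋃ m : ℕ, {ω | (m : ℕ∞) ≤ V ω}ᶜ) = 1 := by
      rw [← measure_univ (μ := P)]
      refine measure_congr ?_
      filter_upwards [hfin] with ω hω
      obtain ⟨l, hl⟩ := ENat.ne_top_iff_exists.1 hω
      refine propext ⟨fun _ ↦ trivial, fun _ ↦ Set.mem_iUnion.2 ⟨l + 1, fun hc ↦ ?_⟩⟩
      have hc : ((l + 1 : ℕ) : ℕ∞) ≤ V ω := hc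
      rw [← hl] at hc
      have : l + 1 ≤ l := by exact_mod_cast hc
      omega
    rw [hmono.measure_iUnion] at h1
    have h2 : (1 : ℝ≥0∞) ≤ 2⁻¹ ^ n := h1 ▸ iSup_le hcon
    have h3 : (2⁻¹ : ℝ≥0∞) ^ n < 1 :=
      pow_lt_one₀ zero_le (ENNReal.inv_lt_one.2 ENNReal.one_lt_two) hn.ne'
    exact absurd h2 (not_le.2 h3)
  classical
  have hspec := Nat.find_spec hex
  have hmin := fun l hl ↦ Nat.find_min hex (m := l) hl
  generalize Nat.find hex = m at hspec hmin
  have hone : ∀ m : ℕ, m ≤ 1 → P {ω | (m : ℕ∞) ≤ V ω}ᶜ ≤ 2⁻¹ ^ n := by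
    intro m hm
    have : {ω | (m : ℕ∞) ≤ V ω}ᶜ = ∅ := by
      refine Set.compl_empty_iff.2 (Set.eq_univ_of_forall fun ω ↦ ?_)
      exact le_trans (by exact_mod_cast hm) (one_le_ballPackingNumber (hAne.image _))
    simp [this]
  have hm2 : 2 ≤ m := by
    by_contra hc
    exact hspec (hone m (by omega))
  obtain ⟨m, rfl⟩ : ∃ m', m = m' + 1 := ⟨m - 1, by omega⟩
  refine ⟨m, by omega, not_not.1 (hmin m (Nat.lt_succ_self m)), ?_⟩
  -- the first alternative of the dichotomy fails for `m + 1`, hence the second one holds; the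
  -- choice `k = 2 n` absorbs the factor `n ≤ 2ⁿ`
  refine ((measure_ballPackingNumber_driftImage_lt_le_or hW hB hind hcont hf hA hε
    (m := m + 1) (by omega) (2 * n) n).resolve_left hspec).trans ?_
  rw [two_mul, pow_add, ← mul_assoc]
  refine mul_le_of_le_one_left zero_le ?_
  rw [← ENNReal.inv_pow, ← div_eq_mul_inv]
  refine ENNReal.div_le_of_le_mul ?_
  rw [one_mul]
  exact_mod_cast n.lt_two_pow_self.le

/-- Almost surely, the packing numbers at the scales `2⁻ⁿ` are eventually confined to
deterministic intervals with end points of ratio quadratic in `n`. -/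
theorem exists_ae_eventually_ballPackingNumber_driftImage (hW : ∀ t, Measurable (W t))
    (hB : ∀ i, IsPreBrownianReal (fun t ω ↦ W t ω i) P)
    (hind : iIndepFun (fun (i : Fin d) (ω : Ω) (t : ℝ≥0) ↦ W t ω i) P)
    (hcont : ∀ᵐ ω ∂P, ∃ w : unitInterval → EuclideanSpace ℝ (Fin d), Continuous w ∧
      ∀ t ∈ A, W (unitInterval.toNNReal t) ω = w t)
    (hf : IsCadlag f) (hA : A.Countable) (hAne : A.Nonempty) :
    ∃ m : ℕ → ℕ, (∀ n, 1 ≤ m n) ∧ ∀ᵐ ω ∂P, ∀ᶠ n in atTop,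
      (m n : ℕ∞) ≤ ballPackingNumber (driftImage W f A ω) (2⁻¹ ^ n) ∧
      ballPackingNumber (driftImage W f A ω) (2⁻¹ ^ n) <
        ((n * ((2 * n + 1) * (m n + 2)) : ℕ) : ℕ∞) := by
  choose m hm1 hlow hup using fun n ↦ exists_ballPackingNumber_driftImage_concentrated hW hB hind
    hcont hf hA hAne (ε := 2⁻¹ ^ n) (by positivity) n
  refine ⟨m, hm1, ?_⟩
  have hsum : ∑' n : ℕ, (2⁻¹ : ℝ≥0∞) ^ n ≠ ∞ := by
    rw [ENNReal.tsum_geometric, ENNReal.one_sub_inv_two, inv_inv]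
    exact ENNReal.ofNat_ne_top
  have h1 := ae_eventually_notMem (ne_top_of_le_ne_top hsum (ENNReal.tsum_le_tsum hlow))
  have h2 := ae_eventually_notMem (ne_top_of_le_ne_top hsum (ENNReal.tsum_le_tsum hup))
  filter_upwards [h1, h2] with ω h1 h2
  filter_upwards [h1, h2] with n h1 h2
  exact ⟨not_not.1 h1, not_le.1 h2⟩

end ImageConcentration

/-! ### Almost sure constancy of the dimensions -/

/-- Two sets whose packing numbers at dyadic scales are confined to the same intervals satisfy the
hypothesis of `minkowskiDim_le_of_eventually`. -/
theorem eventually_ballPackingNumber_le_of_dyadic {E : Type*} [NormedAddCommGroup E]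
    [NormedSpace ℝ E] {S S' T T' : Set E} (hS : S ⊆ closure S') (hT : T' ⊆ T) {m : ℕ → ℕ}
    (hm : ∀ n, 1 ≤ m n)
    (hS' : ∀ᶠ n : ℕ in atTop,
      ballPackingNumber S' (2⁻¹ ^ n) < ((n * ((2 * n + 1) * (m n + 2)) : ℕ) : ℕ∞))
    (hT' : ∀ᶠ n : ℕ in atTop, (m n : ℕ∞) ≤ ballPackingNumber T' (2⁻¹ ^ n)) :
    ∀ᶠ ε : ℝ in 𝓝[>] 0, ∀ a b : ℕ, ballPackingNumber S ε = a →
      ballPackingNumber T (4⁻¹ * ε) = b → (a : ℝ) ≤ 108 * Real.log ε⁻¹ ^ 2 * b := by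
  have hl2 : 0 < Real.log 2 := Real.log_pos one_lt_two
  -- the scale `ε` lies between the dyadic scales `n` and `n + 1`
  have hlim : Tendsto (fun ε : ℝ ↦ ⌊Real.log ε⁻¹ / Real.log 2⌋₊ + 2) (𝓝[>] 0) atTop :=
    (tendsto_add_atTop_nat 2).comp (tendsto_nat_floor_atTop.comp
      (tendsto_log_inv_nhdsGT_zero.atTop_div_const hl2))
  filter_upwards [hlim.eventually hS', hlim.eventually hT', self_mem_nhdsWithin,
    tendsto_log_inv_nhdsGT_zero.eventually (eventually_ge_atTop 1)] with ε hS' hT' hε0 hL a b ha hb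
  have hε0 : 0 < ε := hε0
  have hn1 := Nat.floor_le (div_nonneg (zero_le_one.trans hL) hl2.le)
  have hn2 := Nat.lt_floor_add_one (Real.log ε⁻¹ / Real.log 2)
  generalize ⌊Real.log ε⁻¹ / Real.log 2⌋₊ = n at *
  rw [le_div_iff₀ hl2] at hn1
  have hnL : (n : ℝ) ≤ 2 * Real.log ε⁻¹ := by nlinarith [Real.log_two_gt_d9]
  rw [← Real.log_pow, Real.log_le_log_iff (by positivity) (by positivity),
    le_inv_comm₀ (by positivity) hε0] at hn1
  rw [div_lt_iff₀ hl2, ← Nat.cast_succ, ← Real.log_pow,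
    Real.log_lt_log_iff (by positivity) (by positivity), inv_lt_comm₀ hε0 (by positivity)] at hn2
  have hfine : (2⁻¹ : ℝ) ^ (n + 2) ≤ ε / 2 := by
    rw [Nat.succ_eq_add_one, ← inv_pow] at hn2
    rw [pow_succ]
    linarith
  have hcoarse : 4⁻¹ * ε ≤ (2⁻¹ : ℝ) ^ (n + 2) := by
    rw [← inv_pow] at hn1
    rw [pow_add]
    linarith
  have h1 : (a : ℕ∞) < (((n + 2) * ((2 * (n + 2) + 1) * (m (n + 2) + 2)) : ℕ) : ℕ∞) := by
    rw [← ha]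
    exact ((ballPackingNumber_le_of_subset_closure hε0 hS).trans
      (ballPackingNumber_anti hfine)).trans_lt hS'
  have h2 : (m (n + 2) : ℕ∞) ≤ (b : ℕ∞) := by
    rw [← hb]
    exact hT'.trans ((ballPackingNumber_mono hT).trans (ballPackingNumber_anti hcoarse))
  have h1 : a < (n + 2) * ((2 * (n + 2) + 1) * (m (n + 2) + 2)) := by exact_mod_cast h1
  have h2 : m (n + 2) ≤ b := by exact_mod_cast h2
  have h3 : a ≤ (n + 2) * ((2 * (n + 2) + 1) * (3 * b)) := by
    refine h1.le.trans ?_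
    gcongr
    have := hm (n + 2)
    omega
  have h4 : (a : ℝ) ≤ (n + 2) * ((2 * (n + 2) + 1) * (3 * b)) := by exact_mod_cast h3
  refine h4.trans ?_
  generalize Real.log ε⁻¹ = L at *
  calc ((n : ℝ) + 2) * ((2 * (n + 2) + 1) * (3 * b)) ≤ (4 * L) * (9 * L * (3 * b)) := by
        gcongr <;> linarith
    _ = 108 * L ^ 2 * b := by ring

theorem mainTheorem4 {Ω : Type*} [MeasurableSpace Ω] (P : Measure Ω) [IsProbabilityMeasure P]
    (d : ℕ) (B : ℝ≥0 → Ω → EuclideanSpace ℝ (Fin d)) (hB : IsStandardBrownian B P)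
    (f : unitInterval → EuclideanSpace ℝ (Fin d)) (hf : IsCadlag f)
    (A : Set unitInterval) (hA : A.Nonempty) :
    ∃ c₁ c₂ : ℝ, ∀ᵐ ω ∂P,
      lowerMinkowskiDim ((fun t ↦ B (unitInterval.toNNReal t) ω + f t) '' A) = (c₁ : EReal) ∧
      upperMinkowskiDim ((fun t ↦ B (unitInterval.toNNReal t) ω + f t) '' A) = (c₂ : EReal) := by
  have hmeas : ∀ t i, AEMeasurable (fun ω ↦ B t ω i) P := fun t i ↦ (hB.coord i).aemeasurable t
  -- a modification of `B` that is measurable at each time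
  let W : ℝ≥0 → Ω → EuclideanSpace ℝ (Fin d) := fun t ω ↦ WithLp.toLp 2 fun i ↦ (hmeas t i).mk _ ω
  have hW : ∀ t, Measurable (W t) := fun t ↦
    measurable_of_forall_coord fun i ↦ (hmeas t i).measurable_mk
  have hWB : ∀ i t, (fun ω ↦ B t ω i) =ᵐ[P] fun ω ↦ W t ω i := fun i t ↦ (hmeas t i).ae_eq_mk
  have hWpre : ∀ i, IsPreBrownianReal (fun t ω ↦ W t ω i) P := fun i ↦
    (hB.coord i).toIsPreBrownianReal.congr (hWB i)
  have hind : iIndepFun (fun (i : Fin d) (ω : Ω) (t : ℝ≥0) ↦ W t ω i) P :=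
    hB.indep.process_congr hWB
  obtain ⟨A', hA'A, hA'c, hA'⟩ := exists_countable_forall_mem_closure_image f A
  have hcontB : ∀ᵐ ω ∂P, Continuous fun t : unitInterval ↦ B (unitInterval.toNNReal t) ω := by
    filter_upwards [ae_all_iff.2 fun i ↦ (hB.coord i).cont] with ω hω
    have : Continuous fun t ↦ B t ω := (PiLp.continuous_toLp 2 _).comp (continuous_pi hω)
    exact this.comp unitInterval.toNNReal_continuous
  have hA'ne : A'.Nonempty := by
    rw [← Set.image_nonempty (f := fun t ↦ (0 : EuclideanSpace ℝ (Fin d)) + f t),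
      ← closure_nonempty_iff]
    exact (hA.image _).mono (hA' (fun _ ↦ 0) continuous_const)
  have hWBA : ∀ᵐ ω ∂P, ∀ t ∈ A', W (unitInterval.toNNReal t) ω = B (unitInterval.toNNReal t) ω := by
    refine (ae_ball_iff hA'c).2 fun t _ ↦ ?_
    filter_upwards [ae_all_iff.2 fun i ↦ hWB i (unitInterval.toNNReal t)] with ω hω
    ext i
    exact (hω i).symm
  obtain ⟨m, hm, hconc⟩ := exists_ae_eventually_ballPackingNumber_driftImage (f := f) hW hWpre hind
    (by filter_upwards [hcontB, hWBA] with ω h1 h2 using ⟨_, h1, h2⟩) hf hA'c hA'ne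
  have hgood := (hcontB.and hWBA).and hconc
  have hbdd : ∀ ω, (Continuous fun t : unitInterval ↦ B (unitInterval.toNNReal t) ω) →
      Bornology.IsBounded ((fun t ↦ B (unitInterval.toNNReal t) ω + f t) '' A) := fun ω hω ↦
    (hf.isBounded_range_add hω).subset (Set.image_subset_range _ _)
  -- the constants are the dimensions for one typical path
  obtain ⟨ω₀, ⟨hc₀, hW₀⟩, hm₀⟩ := hgood.exists
  obtain ⟨c₁, c₂, hc₁, hc₂⟩ := exists_coe_eq_minkowskiDim (hA.image _) (hbdd ω₀ hc₀)
  refine ⟨c₁, c₂, ?_⟩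
  filter_upwards [hgood] with ω ⟨⟨hc, hWω⟩, hmω⟩
  rw [← hc₁, ← hc₂]
  rw [driftImage_eq_image hWω] at hmω
  rw [driftImage_eq_image hW₀] at hm₀
  have h1 := minkowskiDim_le_of_eventually (hA.image _) (hbdd ω hc) (hA.image _) (hbdd ω₀ hc₀)
    (by norm_num) (eventually_ballPackingNumber_le_of_dyadic (hA' _ hc) (Set.image_mono hA'A) hm
      (hmω.mono fun _ h ↦ h.2) (hm₀.mono fun _ h ↦ h.1))
  have h2 := minkowskiDim_le_of_eventually (hA.image _) (hbdd ω₀ hc₀) (hA.image _) (hbdd ω hc)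
    (by norm_num) (eventually_ballPackingNumber_le_of_dyadic (hA' _ hc₀) (Set.image_mono hA'A) hm
      (hm₀.mono fun _ h ↦ h.2) (hmω.mono fun _ h ↦ h.1))
  exact ⟨le_antisymm h1.1 h2.1, le_antisymm h1.2 h2.2⟩
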